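/- Let $k$ be a field of characteristic $2$, let $k^\infty$ be the $k$-vector space with basis $e_i$ ($i\in\mathbb{N}$), let $\mathrm{GL}=\mathrm{GL}(k^\infty)$ be the group of its $k$-linear automorphisms, and let $R=\bigwedge(\bigwedge^2(k^\infty))$ be the exterior algebra on $\bigwedge^2(k^\infty)$, which is a commutative ring because $\operatorname{char} k=2$, with the induced action of $\mathrm{GL}$. Write $x_{i,j}=e_i\wedge e_j\in R$, so that $x_{i,j}=x_{j,i}$, $x_{i,i}=0$ and $x_{i,j}^2=0$. For a finite simple graph $G$ with vertices in $\mathbb{N}$, the associated monomial of $R$ is the product of the $x_{i,j}$ over the edges $\{i,j\}$ of $G$. For $n\ge 2$ let $I_n\subseteq R$ be the (ordinary) ideal generated by the Plücker elements $$x_{i_1,i_2}x_{i_3,i_4}+x_{i_1,i_3}x_{i_2,i_4}+x_{i_1,i_4}x_{i_2,i_3}\qquad(i_1,i_2,i_3,i_4\in\mathbb{N})$$ and by the monomials associated to the $i$-cycles with $2<i\le n$ (so $I_2$ is generated by the Plücker elements alone). A $\mathrm{GL}$-stable proper ideal $P$ of $R$ is called $\mathrm{GL}$-prime if, for all $\mathrm{GL}$-stable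 ideals $\mathfrak a,\mathfrak b$ of $R$, $\mathfrak a\mathfrak b\subseteq P$ implies $\mathfrak a\subseteq P$ or $\mathfrak b\subseteq P$. Let $\mathrm{Spec}_{\mathrm{GL}}(R)$ be the set of $\mathrm{GL}$-prime ideals with the Zariski topology, whose closed sets are the sets $V(\mathfrak a)=\{P : \mathfrak a\subseteq P\}$ for $\mathrm{GL}$-stable ideals $\mathfrak a$. Theorem. For every $n\ge 2$, the ideal $I_n$ is $\mathrm{GL}$-stable, so that it defines a closed subset $V(I_n)$ of $\mathrm{Spec}_{\mathrm{GL}}(R)$, and $I_n\subseteq I_{n+1}$ and $I_{n+1}^2\subseteq I_n$. All the ideals $I_n$ with $n\ge 2$ define the same closed subset: $V(I_m)=V(I_n)$ for all $m,n\ge 2$. -/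

import Mathlib

namespace GLSpectrum

noncomputable section

universe u

/-- The exterior algebra `R = ⋀(⋀²(k^∞))`, where `k^∞ = ℕ →₀ k` has basis `e₀, e₁, …`. -/
abbrev R (k : Type u) [Field k] : Type u := ExteriorAlgebra k (⋀[k]^2 (ℕ →₀ k))

/-- `GL = GL(k^∞)`, the group of `k`-linear automorphisms of `k^∞`. -/
abbrev GLInf (k : Type u) [Field k] : Type u := LinearMap.GeneralLinearGroup k (ℕ →₀ k)

theorem add_self_eq_zero {k : Type u} [Field k] [CharP k 2] (f : R k) : f + f = 0 := by
  rw [← two_smul k f, show (2 : k) = 0 from CharP.cast_eq_zero k 2, zero_smul]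

/-- In characteristic two the exterior algebra is commutative. -/
theorem mul_comm_of_char_two {k : Type u} [Field k] [CharP k 2] (f g : R k) :
    f * g = g * f := by
  have key : ∀ v w : ⋀[k]^2 (ℕ →₀ k),
      Commute (ExteriorAlgebra.ι k v) (ExteriorAlgebra.ι k w) := fun v w => by
    have h := ExteriorAlgebra.ι_add_mul_swap (R := k) v w
    have h2 := add_self_eq_zero (ExteriorAlgebra.ι k w * ExteriorAlgebra.ι k v)
    exact add_right_cancel (h.trans h2.symm)
  have hv : ∀ (v : ⋀[k]^2 (ℕ →₀ k)) (g : R k), Commute (ExteriorAlgebra.ι k v) g := by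
    intro v g
    induction g using ExteriorAlgebra.induction with
    | algebraMap r => exact (Algebra.commutes r _).symm
    | ι w => exact key v w
    | mul a b ha hb => exact ha.mul_right hb
    | add a b ha hb => exact ha.add_right hb
  have : Commute f g := by
    induction f using ExteriorAlgebra.induction with
    | algebraMap r => exact Algebra.commutes r _
    | ι w => exact hv w g
    | mul a b ha hb => exact ha.mul_left hb
    | add a b ha hb => exact ha.add_left hb
  exact this

/-- The commutative ring structure on `R` in characteristic two; addition, multiplication and so
on are those of the exterior algebra. -/
instance instCommRingR (k : Type u) [Field k] [CharP k 2] : CommRing (R k) :=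
  { (inferInstance : Ring (R k)) with mul_comm := mul_comm_of_char_two }

/-- The action of `g ∈ GL` on `R` by algebra endomorphisms, induced functorially by the action on
`k^∞`: on generators, `g (v ∧ w) = g v ∧ g w`. -/
def act {k : Type u} [Field k] (g : GLInf k) : R k →ₐ[k] R k :=
  ExteriorAlgebra.map (exteriorPower.map 2 (g : (ℕ →₀ k) →ₗ[k] (ℕ →₀ k)))

/-- `x i j = e_i ∧ e_j`, seen in the degree one part `⋀²(k^∞)` of `R`. -/
def x (k : Type u) [Field k] (i j : ℕ) : R k :=
  ExteriorAlgebra.ι k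
    (exteriorPower.ιMulti k 2 ![Finsupp.single i (1 : k), Finsupp.single j (1 : k)])

theorem x_self (k : Type u) [Field k] (i : ℕ) : x k i i = 0 := by
  unfold x
  rw [(exteriorPower.ιMulti k 2).map_eq_zero_of_eq _ (i := 0) (j := 1) (by simp) (by simp),
    map_zero]

theorem x_comm (k : Type u) [Field k] [CharP k 2] (i j : ℕ) : x k i j = x k j i := by
  have h := (exteriorPower.ιMulti k 2 (M := ℕ →₀ k)).map_swap
    ![Finsupp.single i (1 : k), Finsupp.single j (1 : k)] (i := 0) (j := 1) (by simp)
  have e : (![Finsupp.single i (1 : k), Finsupp.single j (1 : k)] ∘ Equiv.swap (0 : Fin 2) 1)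
      = ![Finsupp.single j (1 : k), Finsupp.single i (1 : k)] := by
    funext t; fin_cases t <;> simp
  rw [e] at h
  have h' : x k j i = -x k i j := by
    unfold x; rw [h, map_neg]
  rw [h', eq_neg_iff_add_eq_zero]
  exact add_self_eq_zero _

/-- The variable attached to an (unordered) edge `{i, j}`. -/
def edgeVar (k : Type u) [Field k] [CharP k 2] : Sym2 ℕ → R k :=
  Sym2.lift ⟨x k, x_comm k⟩

/-- The squarefree monomial `m = ∏_{ {i,j} ∈ E } x_{i,j}` whose graph `G_m` has edge set `E`. -/
def monomial (k : Type u) [Field k] [CharP k 2] (E : Finset (Sym2 ℕ)) : R k :=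
  ∏ e ∈ E, edgeVar k e

/-- `E` is the edge set of an `i`-cycle with vertices in `ℕ` (for `3 ≤ i`): it is the edge set of
the image of the standard cycle graph on `i` vertices under an injective map to `ℕ`. -/
def IsCycleEdgeSet (i : ℕ) (E : Finset (Sym2 ℕ)) : Prop :=
  ∃ v : Fin i ↪ ℕ, (E : Set (Sym2 ℕ)) = ((SimpleGraph.cycleGraph i).map v).edgeSet

/-- The Plücker elements; this vanishes as soon as two of the indices agree. -/
def plucker (k : Type u) [Field k] [CharP k 2] (a b c d : ℕ) : R k :=
  x k a b * x k c d + x k a c * x k b d + x k a d * x k b c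

/-- The ideal `I_n` of `R` generated by the Plücker elements and by the monomials `m` whose graph
is an `i`-cycle with `2 < i ≤ n`. For `n = 2` only the Plücker elements remain. -/
def I (k : Type u) [Field k] [CharP k 2] (n : ℕ) : Ideal (R k) :=
  Ideal.span
    ({f | ∃ a b c d : ℕ, f = plucker k a b c d} ∪
     {f | ∃ (i : ℕ) (E : Finset (Sym2 ℕ)), 2 < i ∧ i ≤ n ∧ IsCycleEdgeSet i E ∧
        f = monomial k E})

/-- An ideal of `R` is `GL`-stable if `g f ∈ a` for all `g ∈ GL` and `f ∈ a`. -/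
def IsGLStable {k : Type u} [Field k] [CharP k 2] (a : Ideal (R k)) : Prop :=
  ∀ g : GLInf k, ∀ f ∈ a, act g f ∈ a

/-- A `GL`-prime ideal: a proper `GL`-stable ideal `P` such that, for all `GL`-stable ideals `a`
and `b`, `a b ⊆ P` implies `a ⊆ P` or `b ⊆ P`. -/
structure IsGLPrime {k : Type u} [Field k] [CharP k 2] (P : Ideal (R k)) : Prop where
  stable : IsGLStable P
  ne_top : P ≠ ⊤
  le_or_le : ∀ a b : Ideal (R k), IsGLStable a → IsGLStable b → a * b ≤ P → a ≤ P ∨ b ≤ P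

/-- The `GL`-spectrum of `R`: the set of `GL`-prime ideals. -/
def SpecGL (k : Type u) [Field k] [CharP k 2] : Type u :=
  {P : Ideal (R k) // IsGLPrime P}

/-- The locus `V(a)` in the `GL`-spectrum: the `GL`-primes containing `a`. -/
def zeroLocus {k : Type u} [Field k] [CharP k 2] (a : Ideal (R k)) : Set (SpecGL k) :=
  {P | a ≤ P.1}

theorem IsGLStable.mul {k : Type u} [Field k] [CharP k 2] {a b : Ideal (R k)}
    (ha : IsGLStable a) (hb : IsGLStable b) : IsGLStable (a * b) := by
  intro g f hf
  refine Submodule.mul_induction_on hf (fun p hp q hq => ?_) (fun p q hp hq => ?_)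
  · rw [map_mul]
    exact Ideal.mul_mem_mul (ha g p hp) (hb g q hq)
  · rw [map_add]
    exact add_mem hp hq

theorem IsGLStable.sSup_mem {k : Type u} [Field k] [CharP k 2] {A : Set (Ideal (R k))}
    (h : ∀ a ∈ A, IsGLStable a) : IsGLStable (sSup A) := by
  intro g
  suffices H : sSup A ≤ (sSup A).comap (act g).toRingHom from fun f hf => H hf
  exact sSup_le fun a ha f hf => (le_sSup ha : a ≤ _) (h a ha g f hf)

/-- The Zariski topology on the `GL`-spectrum: the closed sets are the loci `V(a)` of the
`GL`-stable ideals `a`. -/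
instance instTopologicalSpaceSpecGL (k : Type u) [Field k] [CharP k 2] :
    TopologicalSpace (SpecGL k) :=
  TopologicalSpace.ofClosed {Z | ∃ a : Ideal (R k), IsGLStable a ∧ Z = zeroLocus a}
    ⟨⊤, fun _ _ _ => Submodule.mem_top, by
      ext P
      simp only [Set.mem_empty_iff_false, false_iff]
      exact fun h => P.2.ne_top (top_le_iff.mp h)⟩
    (by
      intro A hA
      let B : Set (Ideal (R k)) := {a | IsGLStable a ∧ zeroLocus a ∈ A}
      refine ⟨sSup B, IsGLStable.sSup_mem fun a ha => ha.1, ?_⟩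
      ext P
      constructor
      · intro h
        have hB : ∀ a ∈ B, a ≤ P.1 := fun a ha => h _ ha.2
        exact (sSup_le hB : sSup B ≤ P.1)
      · intro h Z hZ
        obtain ⟨a, ha, rfl⟩ := hA hZ
        have haB : a ∈ B := ⟨ha, hZ⟩
        exact le_trans (le_sSup haB) (show sSup B ≤ P.1 from h))
    (by
      rintro _ ⟨a, ha, rfl⟩ _ ⟨b, hb, rfl⟩
      refine ⟨a * b, ha.mul hb, ?_⟩
      ext P
      constructor
      · rintro (h | h)
        · exact le_trans Ideal.mul_le_left (show a ≤ P.1 from h)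
        · exact le_trans Ideal.mul_le_right (show b ≤ P.1 from h)
      · exact P.2.le_or_le a b ha hb)

end

end GLSpectrum

/-! View a cycle monomial as a product of a pairing along a closed path. Modulo the Plücker
elements, the product along any path is unchanged by permuting its interior vertices: multiply a
Plücker relation by `X b c` and use `X b c * X b c = 0`. So a closed path depends only on its
multiset of vertices (`pathProd_closed_perm`), and it vanishes when a vertex repeats.

Two consequences carry the theorem. A product of two closed paths is a sum of two equal closed
paths, hence zero in characteristic two (`pathProd_closed_mul_closed`); thus the square of each `I k
n` lies in the Plücker ideal. A closed path is additive in a vertex up to a multiple of a shorter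
closed path (`pathProd_closed_add`); hence closed paths through at most `n` arbitrary vectors lie in
`I k n`, which gives stability. A `GL`-prime containing `I k m` then contains the square of the
stable ideal `I k n`, hence `I k n` itself. -/

namespace GLSpectrum

/-! ### Path products of a Plücker pairing -/

section PathProducts

variable {V A : Type*} [CommRing A]

/-- An alternating symmetric pairing with values in a commutative ring of characteristic two, with
square-zero values, satisfying the Plücker relations. -/
structure IsPluckerPairing (X : V → V → A) : Prop where
  add_self : ∀ a : A, a + a = 0
  self : ∀ u, X u u = 0
  symm : ∀ u v, X u v = X v u
  sq : ∀ u v, X u v * X u v = 0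
  plucker : ∀ a b c d, X a b * X c d + X a c * X b d + X a d * X b c = 0

/-- The product of the values of `X` along the path from `a` to `b` through the vertices of `l`. -/
def pathProd (X : V → V → A) : V → List V → V → A
  | a, [], b => X a b
  | a, c :: l, b => X a c * pathProd X c l b

@[simp] theorem pathProd_nil (X : V → V → A) (a b : V) : pathProd X a [] b = X a b := rfl

@[simp] theorem pathProd_cons (X : V → V → A) (a c : V) (l : List V) (b : V) :
    pathProd X a (c :: l) b = X a c * pathProd X c l b := rfl

theorem pathProd_append_cons (X : V → V → A) (a : V) (l : List V) (c : V) (l' : List V) (b : V) :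
    pathProd X a (l ++ c :: l') b = pathProd X a l c * pathProd X c l' b := by
  induction l generalizing a with
  | nil => rfl
  | cons d l ih => simp [ih, mul_assoc]

theorem map_pathProd {B : Type*} [CommRing B] (f : A →+* B) (X : V → V → A) (a : V) (l : List V)
    (b : V) : f (pathProd X a l b) = pathProd (fun u v => f (X u v)) a l b := by
  induction l generalizing a with
  | nil => rfl
  | cons d l ih => simp [ih]

theorem pathProd_map {W : Type*} (X : V → V → A) (e : W → V) (a : W) (l : List W) (b : W) :
    pathProd X (e a) (l.map e) (e b) = pathProd (fun u v => X (e u) (e v)) a l b := by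
  induction l generalizing a with
  | nil => rfl
  | cons d l ih => simp [ih]

theorem pathProd_ofFn (X : V → V → A) {m : ℕ} (v : Fin (m + 1) → V) (b : V) :
    pathProd X (v 0) (List.ofFn fun i : Fin m => v i.succ) b =
      (∏ i : Fin m, X (v i.castSucc) (v i.succ)) * X (v (Fin.last m)) b := by
  induction m with
  | zero => simp
  | succ m ih =>
    rw [List.ofFn_succ, pathProd_cons, ih fun i => v i.succ, Fin.prod_univ_succ, mul_assoc]
    simp

theorem pathProd_ofFn_closed (X : V → V → A) {m : ℕ} (v : Fin (m + 1) → V) :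
    pathProd X (v 0) (List.ofFn fun i : Fin m => v i.succ) (v 0) =
      ∏ i : Fin (m + 1), X (v i) (v (i + 1)) := by
  rw [pathProd_ofFn, Fin.prod_univ_castSucc, Fin.last_add_one]
  simp [Fin.coeSucc_eq_succ]

namespace IsPluckerPairing

theorem pathProd_swap {X : V → V → A} (hX : IsPluckerPairing X) (a b c d : V) :
    X a b * (X b c * X c d) = X a c * (X c b * X b d) := by
  linear_combination X b c * hX.plucker a b c d - X a d * hX.sq b c
    - X a c * X b d * hX.symm c b - X b c * hX.add_self (X a c * X b d)

theorem pathProd_perm {X : V → V → A} (hX : IsPluckerPairing X) {l l' : List V} (h : l.Perm l')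
    (a b : V) : pathProd X a l b = pathProd X a l' b := by
  induction h generalizing a with
  | nil => rfl
  | cons c _ ih => simp [ih]
  | swap c d l =>
    cases l with
    | nil => simpa using hX.pathProd_swap a d c b
    | cons e l =>
      simp only [pathProd_cons]
      linear_combination pathProd X e l b * hX.pathProd_swap a d c e
  | trans _ _ ih ih' => exact (ih a).trans (ih' a)

theorem pathProd_rev {X : V → V → A} (hX : IsPluckerPairing X) (l : List V) (a b : V) :
    pathProd X a l b = pathProd X b l a := by
  induction l generalizing a with
  | nil => exact hX.symm a b
  | cons c l ih =>
    rw [hX.pathProd_perm (List.perm_append_singleton c l).symm b a, pathProd_append_cons,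
      pathProd_cons, ih, pathProd_nil, hX.symm, mul_comm]

theorem pathProd_rotate {X : V → V → A} (hX : IsPluckerPairing X) (l : List V) (a c : V) :
    pathProd X a (c :: l) a = pathProd X c (a :: l) c := by
  rw [hX.pathProd_perm (List.perm_append_singleton a l).symm c c, pathProd_append_cons,
    pathProd_cons, pathProd_nil, mul_comm]

/-- Interior vertices already commute; rotating the closed path lets the base point join in. -/
theorem pathProd_closed_perm {X : V → V → A} (hX : IsPluckerPairing X) {a b : V} {l l' : List V}
    (h : (a :: l).Perm (b :: l')) : pathProd X a l a = pathProd X b l' b := by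
  by_cases hab : a = b
  · subst hab
    exact hX.pathProd_perm ((List.perm_cons a).mp h) a a
  · have hb : b ∈ l := by
      have := h.symm.subset List.mem_cons_self
      simpa [Ne.symm hab] using this
    obtain ⟨s, t, rfl⟩ := List.append_of_mem hb
    rw [hX.pathProd_perm (List.perm_middle (a := b)), hX.pathProd_rotate]
    apply hX.pathProd_perm
    have h2 : (b :: a :: (s ++ t)).Perm (b :: l') :=
      ((List.Perm.swap a b _).trans ((List.perm_middle (a := b)).symm.cons a)).trans h
    exact (List.perm_cons b).mp h2

/-- Reordering makes two copies of `b` adjacent, which produces a factor `X b b = 0`. -/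
theorem pathProd_closed_eq_zero_of_not_nodup {X : V → V → A} (hX : IsPluckerPairing X) {a : V}
    {l : List V} (h : ¬ (a :: l).Nodup) : pathProd X a l a = 0 := by
  obtain ⟨b, hb⟩ : ∃ b, List.Duplicate b (a :: l) := by
    simpa [List.nodup_iff_forall_not_duplicate] using h
  obtain ⟨l', h2⟩ := (List.duplicate_iff_sublist.mp hb).exists_perm_append
  rw [hX.pathProd_closed_perm h2, List.append_eq, List.cons_append, pathProd_cons,
    hX.self, zero_mul]

/-- The product of two closed paths vanishes. -/
theorem pathProd_closed_mul_closed {X : V → V → A} (hX : IsPluckerPairing X) (a b : V)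
    (l : List V) (c d : V) (l' : List V) :
    pathProd X a (b :: l) a * pathProd X c (d :: l') c = 0 := by
  -- Cut the edges `ab` and `cd`. The Plücker relation reconnects the two open paths in two ways,
  -- each a single closed path through the same vertices, so the two terms are equal and cancel.
  have h1 : pathProd X b (d :: (l' ++ c :: a :: l)) b =
      X b d * (pathProd X d l' c * (X c a * pathProd X a l b)) := by
    rw [pathProd_cons, pathProd_append_cons, pathProd_cons]
  have h2 : pathProd X b (c :: (l' ++ d :: a :: l)) b =
      X b c * (pathProd X c l' d * (X d a * pathProd X a l b)) := by
    rw [pathProd_cons, pathProd_append_cons, pathProd_cons]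
  have h3 : pathProd X b (d :: (l' ++ c :: a :: l)) b =
      pathProd X b (c :: (l' ++ d :: a :: l)) b := by
    apply hX.pathProd_perm
    exact ((List.perm_middle (a := c)).cons d).trans
      ((List.Perm.swap c d _).trans ((List.perm_middle (a := d)).symm.cons c))
  rw [h1, h2, hX.pathProd_rev l' c d, hX.symm c a, hX.symm d a] at h3
  rw [pathProd_cons, pathProd_cons, hX.pathProd_rev l b a]
  linear_combination pathProd X a l b * pathProd X d l' c * hX.plucker a b c d - h3
    - hX.add_self (X a d * X b c * pathProd X a l b * pathProd X d l' c)

/-- A closed path through a sum of two vertices, when `X` is additive. -/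
theorem pathProd_closed_add [Add V] {X : V → V → A} (hX : IsPluckerPairing X)
    (hadd : ∀ u v w, X (u + v) w = X u w + X v w) (u v c d : V) (l : List V) :
    pathProd X (u + v) (c :: (l ++ [d])) (u + v) =
      pathProd X u (c :: (l ++ [d])) u + pathProd X v (c :: (l ++ [d])) v
        + X u v * pathProd X c (l ++ [d]) c := by
  simp only [pathProd_cons, pathProd_append_cons, pathProd_nil]
  rw [hX.symm d (u + v), hX.symm d u, hX.symm d v, hadd, hadd]
  -- The cross terms `X u c * X v d + X v c * X u d` equal `X u v * X c d`, and the edge `cd` closes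
  -- up the path from `c` to `d`.
  linear_combination pathProd X c l d * hX.plucker u v c d
    - X u v * pathProd X c l d * hX.symm d c - hX.add_self (X u v * pathProd X c l d * X c d)

end IsPluckerPairing

end PathProducts

end GLSpectrum
-- From basis vectors to arbitrary vectors
namespace GLSpectrum

/-- Vanishing of closed paths on basis vectors implies vanishing on all vectors. -/
theorem IsPluckerPairing.pathProd_closed_eq_zero_of_basis {k A : Type*} [Field k] [CommRing A]
    {X : (ℕ →₀ k) → (ℕ →₀ k) → A} (hX : IsPluckerPairing X)
    (hadd : ∀ u v w, X (u + v) w = X u w + X v w)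
    (φ : k → A) (hsmul : ∀ c u w, X (c • u) w = φ c * X u w) (n : ℕ)
    (hbasis : ∀ (i : ℕ) (q : List ℕ), q.length + 1 ≤ n →
      pathProd (fun i j => X (Finsupp.single i 1) (Finsupp.single j 1)) i q i = 0)
    (a : ℕ →₀ k) (l : List (ℕ →₀ k)) (hl : l.length + 1 ≤ n) : pathProd X a l a = 0 := by
  have hzero : ∀ w, X 0 w = 0 := fun w => by simpa using hadd 0 0 w
  induction hm : l.length using Nat.strong_induction_on generalizing a l with
  | _ m IH =>
  subst hm
  -- Induction on the number of vertices not yet replaced by basis vectors; the total length stays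
  -- fixed, so `IH` remains available for shorter paths.
  have main : ∀ (p : List (ℕ →₀ k)) (q : List ℕ) (b : ℕ →₀ k) (t : List (ℕ →₀ k)),
      (b :: t).Perm (p ++ q.map fun i => Finsupp.single i 1) → t.length = l.length →
      pathProd X b t b = 0 := by
    intro p
    induction p with
    | nil =>
      intro q b t h ht
      cases q with
      | nil => simp at h
      | cons i q =>
        have hq := h.length_eq
        rw [hX.pathProd_closed_perm h, pathProd_map X (fun i => Finsupp.single i (1 : k))]
        exact hbasis i q (by simp at hq; omega)
    | cons v p ihp =>
      intro q b t h ht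
      rw [hX.pathProd_closed_perm h]
      have hlen := h.length_eq
      have ih' : ∀ i : ℕ, pathProd X (Finsupp.single i 1)
          (p ++ q.map fun i => Finsupp.single i 1) (Finsupp.single i 1) = 0 := fun i =>
        ihp (i :: q) _ _ List.perm_middle.symm (by simp at hlen ⊢; omega)
      rw [List.append_eq]
      have hs : (p ++ q.map fun i => Finsupp.single i (1 : k)).length = l.length := by
        simp at hlen ⊢; omega
      generalize (p ++ q.map fun i => Finsupp.single i 1) = s at ih' hs
      clear h hlen ihp
      -- One or two vertices give zero directly; from three on, `v` has separate neighbours `c` and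
      -- `d`, as the additivity formula requires.
      rcases s with _ | ⟨c, s⟩
      · exact hX.self v
      rcases List.eq_nil_or_concat' s with rfl | ⟨s, d, rfl⟩
      · rw [pathProd_cons, pathProd_nil, hX.symm c v, hX.sq]
      induction v using Finsupp.induction_linear with
      | zero => rw [pathProd_cons, hzero, zero_mul]
      | add u w hu hw =>
        rw [hX.pathProd_closed_add hadd, hu, hw,
          IH (s ++ [d]).length (by simp at hs ⊢; omega) c (s ++ [d]) (by simp at hs ⊢; omega) rfl]
        simp
      | single i r =>
        have hi := ih' i
        rw [← mul_one r, ← smul_eq_mul, ← Finsupp.smul_single]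
        simp only [pathProd_cons, pathProd_append_cons, pathProd_nil] at hi ⊢
        rw [hX.symm d] at hi ⊢
        rw [hsmul, hsmul]
        -- The scalar appears twice because the vertex lies on two edges.
        linear_combination φ r * φ r * hi
  exact main (a :: l) [] a l (by simp) rfl

/-! ### The wedge pairing and its Plücker relations -/

noncomputable section

universe u

/-- The product `u ∧ v` of two vectors, as an element of degree one of `R`. -/
def wedge (k : Type u) [Field k] (v w : ℕ →₀ k) : R k :=
  ExteriorAlgebra.ι k (exteriorPower.ιMulti k 2 ![v, w])

variable {k : Type u} [Field k]

theorem wedge_add_left (u v w : ℕ →₀ k) : wedge k (u + v) w = wedge k u w + wedge k v w := by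
  unfold wedge
  rw [AlternatingMap.map_vecCons_add, map_add]

theorem wedge_smul_left (c : k) (u w : ℕ →₀ k) :
    wedge k (c • u) w = algebraMap k (R k) c * wedge k u w := by
  unfold wedge
  rw [AlternatingMap.map_vecCons_smul, map_smul, Algebra.smul_def]

theorem wedge_self (u : ℕ →₀ k) : wedge k u u = 0 := by
  unfold wedge
  rw [(exteriorPower.ιMulti k 2).map_eq_zero_of_eq _ (i := 0) (j := 1) (by simp) (by simp),
    map_zero]

theorem wedge_mul_self (u v : ℕ →₀ k) : wedge k u v * wedge k u v = 0 :=
  ExteriorAlgebra.ι_sq_zero _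

theorem act_wedge (g : GLInf k) (u v : ℕ →₀ k) :
    act g (wedge k u v) = wedge k ((g : (ℕ →₀ k) →ₗ[k] (ℕ →₀ k)) u)
      ((g : (ℕ →₀ k) →ₗ[k] (ℕ →₀ k)) v) := by
  unfold act wedge
  rw [ExteriorAlgebra.map_apply_ι, exteriorPower.map_apply_ιMulti]
  congr 2

variable [CharP k 2]

theorem wedge_comm (u v : ℕ →₀ k) : wedge k u v = wedge k v u := by
  have h := (exteriorPower.ιMulti k 2 (M := ℕ →₀ k)).map_swap ![u, v] (i := 0) (j := 1) (by simp)
  have e : (![u, v] ∘ Equiv.swap (0 : Fin 2) 1) = ![v, u] := by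
    funext t; fin_cases t <;> simp
  rw [e] at h
  have h' : wedge k v u = -wedge k u v := by
    unfold wedge; rw [h, map_neg]
  rw [h', eq_neg_iff_add_eq_zero]
  exact add_self_eq_zero _

/-- The Plücker expression of four vectors lies in any ideal containing those of the basis. -/
theorem wedge_plucker_mem {J : Ideal (R k)} (hJ : ∀ a b c d, plucker k a b c d ∈ J)
    (u v w z : ℕ →₀ k) :
    wedge k u v * wedge k w z + wedge k u w * wedge k v z + wedge k u z * wedge k v w ∈ J := by
  have zero_left : ∀ w, wedge k 0 w = 0 := fun w => by simpa using wedge_add_left 0 0 w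
  have add_right : ∀ u v w, wedge k w (u + v) = wedge k w u + wedge k w v := fun u v w => by
    rw [wedge_comm, wedge_add_left, wedge_comm u, wedge_comm v]
  have zero_right : ∀ w, wedge k w 0 = 0 := fun w => by simpa using add_right 0 0 w
  have single_left : ∀ (i : ℕ) (r : k) (w : ℕ →₀ k), wedge k (Finsupp.single i r) w =
      algebraMap k (R k) r * wedge k (Finsupp.single i 1) w := fun i r w => by
    rw [← wedge_smul_left, Finsupp.smul_single, smul_eq_mul, mul_one]
  have single_right : ∀ (i : ℕ) (r : k) (w : ℕ →₀ k), wedge k w (Finsupp.single i r) =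
      algebraMap k (R k) r * wedge k w (Finsupp.single i 1) := fun i r w => by
    rw [wedge_comm, single_left, wedge_comm w]
  induction u using Finsupp.induction_linear with
  | zero => simp [zero_left]
  | add u u' hu hu' =>
    convert J.add_mem hu hu' using 1
    simp only [wedge_add_left]; ring
  | single i r =>
  induction v using Finsupp.induction_linear with
  | zero => simp [zero_left, zero_right]
  | add u u' hu hu' =>
    convert J.add_mem hu hu' using 1
    simp only [wedge_add_left, add_right]; ring
  | single j s =>
  induction w using Finsupp.induction_linear with
  | zero => simp [zero_left, zero_right]
  | add u u' hu hu' =>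
    convert J.add_mem hu hu' using 1
    simp only [wedge_add_left, add_right]; ring
  | single l t =>
  induction z using Finsupp.induction_linear with
  | zero => simp [zero_right]
  | add u u' hu hu' =>
    convert J.add_mem hu hu' using 1
    simp only [add_right]; ring
  | single m q =>
    convert J.mul_mem_left (algebraMap k (R k) r * algebraMap k (R k) s * algebraMap k (R k) t *
      algebraMap k (R k) q) (hJ i j l m) using 1
    rw [single_left i r, single_left i r, single_left i r, single_right j s, single_left j s,
      single_left j s, single_left l t, single_right l t, single_right l t, single_right m q,
      single_right m q, single_right m q]
    unfold plucker x
    simp only [wedge]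
    ring

theorem plucker_mem_I (n a b c d : ℕ) : plucker k a b c d ∈ I k n :=
  Ideal.subset_span (Or.inl ⟨a, b, c, d, rfl⟩)

/-- The pairing on vectors with values in the quotient of `R` by an ideal containing the Plücker
elements. -/
def quotWedge (J : Ideal (R k)) (u v : ℕ →₀ k) : R k ⧸ J := Ideal.Quotient.mk J (wedge k u v)

theorem isPluckerPairing_quotWedge {J : Ideal (R k)} (hJ : ∀ a b c d, plucker k a b c d ∈ J) :
    IsPluckerPairing (quotWedge J) where
  add_self a := by
    obtain ⟨f, rfl⟩ := Ideal.Quotient.mk_surjective a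
    rw [← map_add, add_self_eq_zero, map_zero]
  self u := by rw [quotWedge, wedge_self, map_zero]
  symm u v := by rw [quotWedge, wedge_comm, quotWedge]
  sq u v := by rw [quotWedge, ← map_mul, wedge_mul_self, map_zero]
  plucker a b c d := by
    simp only [quotWedge, ← map_mul, ← map_add]
    exact Ideal.Quotient.eq_zero_iff_mem.mpr (wedge_plucker_mem hJ a b c d)

/-! ### Cycle monomials as closed path products -/

theorem edgeSet_cycleGraph_map {m : ℕ} (v : Fin (m + 3) ↪ ℕ) :
    ((SimpleGraph.cycleGraph (m + 3)).map v).edgeSet =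
      Set.range fun i : Fin (m + 3) => s(v i, v (i + 1)) := by
  ext e
  induction e with
  | _ a b =>
  simp only [SimpleGraph.mem_edgeSet, SimpleGraph.map_adj, SimpleGraph.cycleGraph_adj,
    Set.mem_range, Sym2.eq_iff]
  constructor
  · rintro ⟨i, j, h | h, rfl, rfl⟩
    · exact ⟨j, Or.inr ⟨rfl, by rw [← h]; simp⟩⟩
    · exact ⟨i, Or.inl ⟨rfl, by rw [← h]; simp⟩⟩
  · rintro ⟨i, ⟨rfl, rfl⟩ | ⟨rfl, rfl⟩⟩
    · exact ⟨i, i + 1, Or.inr (by simp), rfl, rfl⟩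
    · exact ⟨i + 1, i, Or.inl (by simp), rfl, rfl⟩

theorem cycle_edge_injective {m : ℕ} (v : Fin (m + 3) ↪ ℕ) :
    Function.Injective fun i : Fin (m + 3) => s(v i, v (i + 1)) := by
  intro i j h
  simp only [Sym2.eq_iff, v.injective.eq_iff] at h
  rcases h with h | ⟨h1, h2⟩
  · exact h.1
  · exfalso
    -- Two edges matching with reversed ends would force `2 = 0` modulo `m + 3`.
    rw [h1, add_assoc] at h2
    have h3 : (1 + 1 : Fin (m + 3)) = 0 := by simpa using h2
    have := congrArg Fin.val h3
    simp [Fin.val_add, Nat.mod_eq_of_lt] at this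

theorem monomial_cycle {m : ℕ} (v : Fin (m + 3) ↪ ℕ) {E : Finset (Sym2 ℕ)}
    (hE : (E : Set (Sym2 ℕ)) = ((SimpleGraph.cycleGraph (m + 3)).map v).edgeSet) :
    monomial k E = pathProd (x k) (v 0) (List.ofFn fun i : Fin (m + 2) => v i.succ) (v 0) := by
  have h : E = Finset.univ.map ⟨_, cycle_edge_injective v⟩ := by
    apply Finset.coe_injective
    rw [hE, edgeSet_cycleGraph_map]
    simp
  rw [pathProd_ofFn_closed, h, monomial, Finset.prod_map]
  rfl

/-- Closed paths with a repeated vertex or fewer than three vertices vanish by the pairing axioms;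
the others are generators of `I k n`. -/
theorem quotWedge_basis_closed_eq_zero (n i : ℕ) (q : List ℕ) (hq : q.length + 1 ≤ n) :
    pathProd (fun i j => quotWedge (I k n) (Finsupp.single i 1) (Finsupp.single j 1)) i q i
      = 0 := by
  have hX : IsPluckerPairing
      (fun i j => quotWedge (I k n) (Finsupp.single i 1) (Finsupp.single j 1)) := by
    have h := isPluckerPairing_quotWedge (plucker_mem_I (k := k) n)
    exact ⟨h.add_self, fun _ => h.self _, fun _ _ => h.symm _ _, fun _ _ => h.sq _ _,
      fun _ _ _ _ => h.plucker _ _ _ _⟩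
  by_cases hnd : (i :: q).Nodup
  · rcases q with _ | ⟨a, _ | ⟨b, q⟩⟩
    · exact hX.self i
    · rw [pathProd_cons, pathProd_nil, hX.symm a i, hX.sq]
    · let v : Fin (q.length + 3) ↪ ℕ := ⟨(i :: a :: b :: q).get, hnd.injective_get⟩
      have hv : ((Finset.univ.map ⟨_, cycle_edge_injective v⟩ : Finset (Sym2 ℕ)) :
          Set (Sym2 ℕ)) = ((SimpleGraph.cycleGraph (q.length + 3)).map v).edgeSet := by
        rw [edgeSet_cycleGraph_map]; simp
      have hl : (List.ofFn fun i : Fin (q.length + 2) => v i.succ) = a :: b :: q :=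
        List.ofFn_get (a :: b :: q)
      have hm := monomial_cycle (k := k) v hv
      rw [hl] at hm
      change _ = pathProd (x k) i (a :: b :: q) i at hm
      have hmem : monomial k _ ∈ I k n :=
        Ideal.subset_span (Or.inr ⟨q.length + 3, _, by omega, hq, ⟨v, hv⟩, rfl⟩)
      rw [hm, ← Ideal.Quotient.eq_zero_iff_mem, map_pathProd] at hmem
      exact hmem
  · exact hX.pathProd_closed_eq_zero_of_not_nodup hnd

theorem pathProd_wedge_mem_I (n : ℕ) (a : ℕ →₀ k) (l : List (ℕ →₀ k)) (hl : l.length + 1 ≤ n) :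
    pathProd (wedge k) a l a ∈ I k n := by
  rw [← Ideal.Quotient.eq_zero_iff_mem, map_pathProd]
  refine (isPluckerPairing_quotWedge (plucker_mem_I n)).pathProd_closed_eq_zero_of_basis
    (fun u v w => ?_) (fun c => Ideal.Quotient.mk _ (algebraMap k (R k) c)) (fun c u w => ?_) n
    (quotWedge_basis_closed_eq_zero n) a l hl
  · rw [quotWedge, wedge_add_left, map_add]; rfl
  · rw [quotWedge, wedge_smul_left, map_mul]; rfl

theorem exists_path_of_isCycleEdgeSet {i : ℕ} {E : Finset (Sym2 ℕ)} (hi : 2 < i)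
    (hE : IsCycleEdgeSet i E) : ∃ (a b : ℕ) (l : List ℕ), l.length + 2 = i ∧
      monomial k E = pathProd (wedge k) (Finsupp.single a 1)
        ((b :: l).map fun j => Finsupp.single j 1) (Finsupp.single a 1) := by
  obtain ⟨m, rfl⟩ : ∃ m, i = m + 3 := ⟨i - 3, by omega⟩
  obtain ⟨v, hv⟩ := hE
  refine ⟨v 0, v (Fin.succ 0), List.ofFn fun j : Fin (m + 1) => v j.succ.succ, by simp, ?_⟩
  rw [monomial_cycle v hv, pathProd_map (wedge k) (fun j => Finsupp.single j (1 : k)),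
    List.ofFn_succ]
  rfl

/-! ### Stability, squares and zero loci -/

theorem isGLStable_I (n : ℕ) : IsGLStable (I k n) := by
  intro g
  suffices H : I k n ≤ (I k n).comap (act g).toRingHom from fun f hf => H hf
  refine Ideal.span_le.mpr ?_
  rintro f (⟨a, b, c, d, rfl⟩ | ⟨i, E, hi, hin, hE, rfl⟩)
  · change act g (wedge k _ _ * wedge k _ _ + wedge k _ _ * wedge k _ _
      + wedge k _ _ * wedge k _ _) ∈ I k n
    simp only [map_add, map_mul, act_wedge]
    exact wedge_plucker_mem (plucker_mem_I n) _ _ _ _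
  · obtain ⟨a, b, l, hl, h⟩ := exists_path_of_isCycleEdgeSet (k := k) hi hE
    change (act g).toRingHom (monomial k E) ∈ I k n
    rw [h, map_pathProd]
    have hg : (fun u v => (act g).toRingHom (wedge k u v)) =
        fun u v => wedge k ((g : (ℕ →₀ k) →ₗ[k] (ℕ →₀ k)) u)
          ((g : (ℕ →₀ k) →ₗ[k] (ℕ →₀ k)) v) := by
      funext u v; exact act_wedge g u v
    -- The image of a cycle monomial is a closed path of the same length through the vectors `g
    -- e_j`.
    rw [hg, ← pathProd_map (wedge k) (g : (ℕ →₀ k) →ₗ[k] (ℕ →₀ k))]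
    exact pathProd_wedge_mem_I n _ _ (by simp; omega)

theorem I_mono : Monotone (I k) := by
  intro m n hmn
  refine Ideal.span_mono (Set.union_subset_union_right _ ?_)
  rintro f ⟨i, E, hi, him, h⟩
  exact ⟨i, E, hi, him.trans hmn, h⟩

/-- The square of `I_n` is contained in the ideal generated by the Plücker elements. -/
theorem I_sq_le (n m : ℕ) : I k n ^ 2 ≤ I k m := by
  rw [pow_two, I, Ideal.span_mul_span', Ideal.span_le]
  rintro _ ⟨f, hf, g, hg, rfl⟩
  rcases hf with ⟨a, b, c, d, rfl⟩ | ⟨i, E, hi, -, hE, rfl⟩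
  · exact Ideal.mul_mem_right _ _ (plucker_mem_I m a b c d)
  rcases hg with ⟨a, b, c, d, rfl⟩ | ⟨j, F, hj, -, hF, rfl⟩
  · exact Ideal.mul_mem_left _ _ (plucker_mem_I m a b c d)
  obtain ⟨a, b, l, -, h⟩ := exists_path_of_isCycleEdgeSet (k := k) hi hE
  obtain ⟨c, d, l', -, h'⟩ := exists_path_of_isCycleEdgeSet (k := k) hj hF
  change monomial k E * monomial k F ∈ I k m
  rw [h, h', ← Ideal.Quotient.eq_zero_iff_mem, map_mul, map_pathProd, map_pathProd]
  exact (isPluckerPairing_quotWedge (plucker_mem_I m)).pathProd_closed_mul_closed _ _ _ _ _ _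

theorem zeroLocus_I_subset (m n : ℕ) : zeroLocus (I k m) ⊆ zeroLocus (I k n) := by
  intro P hP
  have h : I k n * I k n ≤ P.1 := by
    rw [← pow_two]
    exact (I_sq_le n m).trans hP
  exact (P.2.le_or_le _ _ (isGLStable_I n) (isGLStable_I n) h).elim id id

theorem isClosed_zeroLocus {a : Ideal (R k)} (ha : IsGLStable a) : IsClosed (zeroLocus a) :=
  ⟨⟨a, ha, compl_compl _⟩⟩

end

end GLSpectrum

theorem theorem1p4 (k : Type*) [Field k] [CharP k 2] :
    (∀ n : ℕ, 2 ≤ n →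
      GLSpectrum.IsGLStable (GLSpectrum.I k n) ∧
      IsClosed (GLSpectrum.zeroLocus (GLSpectrum.I k n)) ∧
      GLSpectrum.I k n ≤ GLSpectrum.I k (n + 1) ∧
      GLSpectrum.I k (n + 1) ^ 2 ≤ GLSpectrum.I k n) ∧
    (∀ m n : ℕ, 2 ≤ m → 2 ≤ n →
      GLSpectrum.zeroLocus (GLSpectrum.I k m) = GLSpectrum.zeroLocus (GLSpectrum.I k n)) :=
  ⟨fun n _ => ⟨GLSpectrum.isGLStable_I n,
      GLSpectrum.isClosed_zeroLocus (GLSpectrum.isGLStable_I n),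
      GLSpectrum.I_mono n.le_succ, GLSpectrum.I_sq_le (n + 1) n⟩,
    fun m n _ _ => (GLSpectrum.zeroLocus_I_subset m n).antisymm
      (GLSpectrum.zeroLocus_I_subset n m)⟩
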